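/- Let $n\ge 0$ and $m\ge 0$ be integers. For $c=(c_1,\dots,c_k)\in\mathbb R^k$ let $\mathcal C(c)\in\mathbb R^{k\times k}$ be the companion matrix with ones on the superdiagonal, last row $(-c_1,\dots,-c_k)$ and zeros elsewhere. Let $a\in\mathbb R^n$ be such that the eigenvalues of $\Phi(a)=\mathcal C(a)$ are pairwise distinct with zero real part, and let $v:[0,\infty)\to\mathbb R^n$ be a solution of the exosystem $\dot v=\Phi(a)v$ with output $y_0=\Gamma v$, $\Gamma=[1\;0\;\cdots\;0]$. Suppose that $y_0$ is a multi-tone signal with $m$ distinct frequencies, $$y_0(t)=d_0+\sum_{k=1}^m d_k\sin(\omega_k t+\phi_k),\qquad t\ge 0,$$ with $d_k\neq 0$, $\omega_k\ne 0$, $|\omega_1|,\dots,|\omega_m|$ pairwise distinct, and either $n=2m$, $d_0=0$ or $n=2m+1$, $d_0\ne0$. Let $m_1,\dots,m_{2n}\in\mathbb R$ be such that $M=\mathcal C(m_1,\dots,m_{2n})$ is Hurwitz, let $N=[0\;\cdots\;0\;1]^\top\in\mathbb R^{2n}$, let $k_1>0$, and for $\theta\in\mathbb R^{2n}$ let $\Theta(\theta)\in\mathbb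 R^{n\times n}$ be the Hankel matrix with entries $\Theta(\theta)_{ij}=\theta_{i+j-1}$. Let $(\eta,\hat a):[0,\infty)\to\mathbb R^{2n}\times\mathbb R^n$ be any solution of the observer $$\dot\eta=M\eta+Ny_0,\qquad \dot{\hat a}=-k_1\Theta(\eta)^\top\big[\Theta(\eta)\hat a+\mathrm{col}(\eta_{n+1},\dots,\eta_{2n})\big].$$ Then there are $t_0\ge 0$, $C>0$ and $\lambda>0$ such that $\Theta(\eta(t))$ is invertible for all $t\ge t_0$, the function $t\mapsto\Theta(\eta(t))$ is smooth on $[t_0,\infty)$, and $$\Big\|a-\Big(-\Theta(\eta(t))^{-1}\,\mathrm{col}(\eta_{n+1}(t),\dots,\eta_{2n}(t))\Big)\Big\|\le C e^{-\lambda (t-t_0)}\qquad\text{for all } t\ge t_0,$$ where $\|\cdot\|$ is the Euclidean norm; that is, $-\Theta(\eta(t))^{-1}\mathrm{col}(\eta_{n+1}(t),\dots,\eta_{2n}(t))$ converges exponentially to $a$. -/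

import Mathlib

open scoped Matrix ContDiff

namespace MultiTone

/-- The `k × k` companion matrix with superdiagonal ones and last row `-c₁, …, -c_k`
(the entries of `c` are indexed from `0`).  With `c = a` and `k = n` this is `Φ(a)`;
with `c = (m₁, …, m_{2n})` and `k = 2n` this is `M`. -/
def companion {k : ℕ} (c : Fin k → ℝ) : Matrix (Fin k) (Fin k) ℝ :=
  Matrix.of fun i j =>
    if (i : ℕ) + 1 = k then -c j else if (i : ℕ) + 1 = (j : ℕ) then 1 else 0

/-- The output row `Γ = [1 0 ⋯ 0]`. -/
def Gam (n : ℕ) : Fin n → ℝ := fun j => if (j : ℕ) = 0 then 1 else 0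

/-- The input column `N = [0 ⋯ 0 1]ᵀ` of length `2n`. -/
def Nvec (n : ℕ) : Fin (2 * n) → ℝ := fun i => if (i : ℕ) + 1 = 2 * n then 1 else 0

/-- The real Hankel matrix `Θ(θ)`, with entry `θ_{i+j-1}` in place `(i, j)` when indices
start at `1`. -/
def Theta {n : ℕ} (θ : Fin (2 * n) → ℝ) : Matrix (Fin n) (Fin n) ℝ :=
  Matrix.of fun i j => θ ⟨(i : ℕ) + (j : ℕ), by omega⟩

/-- The lower half `col(θ_{n+1}, …, θ_{2n})`. -/
def lowerHalf {n : ℕ} (θ : Fin (2 * n) → ℝ) : Fin n → ℝ :=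
  fun i => θ ⟨n + (i : ℕ), by omega⟩

/-- All complex eigenvalues have negative real part. -/
def IsHurwitz {k : ℕ} (A : Matrix (Fin k) (Fin k) ℝ) : Prop :=
  ∀ μ ∈ spectrum ℂ (A.map (algebraMap ℝ ℂ)), μ.re < 0

/-- The complex eigenvalues are pairwise distinct (the characteristic polynomial has no
repeated root) and all have zero real part. -/
def HasDistinctImaginaryEigenvalues {k : ℕ} (A : Matrix (Fin k) (Fin k) ℝ) : Prop :=
  (A.map (algebraMap ℝ ℂ)).charpoly.roots.Nodup ∧
    ∀ μ ∈ spectrum ℂ (A.map (algebraMap ℝ ℂ)), μ.re = 0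

/-- `v` solves the exosystem `v' = Φ(a) v` on `[0, ∞)` (one-sided derivative at `0`). -/
def IsExosystemSolution {n : ℕ} (a : Fin n → ℝ) (v : ℝ → Fin n → ℝ) : Prop :=
  ∀ t ∈ Set.Ici (0 : ℝ), HasDerivWithinAt v (companion a *ᵥ v t) (Set.Ici 0) t

/-- On `[0, ∞)` the signal `y` is `d₀ + ∑ d_k sin (w_k t + φ_k)` with `m` nonzero amplitudes and
`m` distinct nonzero frequencies (`w` and `-w` count as the same frequency), where
`n = 2m` if there is no bias and `n = 2m + 1` if there is one. -/
structure IsMultiToneSignal (n m : ℕ) (d₀ : ℝ) (d w φ : Fin m → ℝ) (y : ℝ → ℝ) : Prop where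
  order : (n = 2 * m ∧ d₀ = 0) ∨ (n = 2 * m + 1 ∧ d₀ ≠ 0)
  amplitude_ne_zero : ∀ k, d k ≠ 0
  frequency_ne_zero : ∀ k, w k ≠ 0
  frequency_distinct : Function.Injective fun k => |w k|
  eq_sum : ∀ t ∈ Set.Ici (0 : ℝ), y t = d₀ + ∑ k, d k * Real.sin (w k * t + φ k)

/-- `(η, â)` solves on `[0, ∞)` the observer
`η' = M η + N y`, `â' = -k₁ Θ(η)ᵀ [Θ(η) â + col(η_{n+1}, …, η_{2n})]`,
from arbitrary initial values, where `M` is the companion matrix of `c = (m₁, …, m_{2n})`. -/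
structure IsObserverSolution {n : ℕ} (c : Fin (2 * n) → ℝ) (k₁ : ℝ) (y : ℝ → ℝ)
    (η : ℝ → Fin (2 * n) → ℝ) (ahat : ℝ → Fin n → ℝ) : Prop where
  eta_ode : ∀ t ∈ Set.Ici (0 : ℝ),
    HasDerivWithinAt η (companion c *ᵥ η t + y t • Nvec n) (Set.Ici 0) t
  ahat_ode : ∀ t ∈ Set.Ici (0 : ℝ),
    HasDerivWithinAt ahat
      (-(k₁ • ((Theta (η t))ᵀ *ᵥ (Theta (η t) *ᵥ ahat t + lowerHalf (η t)))))
      (Set.Ici 0) t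

/-- The explicit estimate `-Θ(θ)⁻¹ col(θ_{n+1}, …, θ_{2n})`. -/
noncomputable def explicitEstimate {n : ℕ} (θ : Fin (2 * n) → ℝ) : Fin n → ℝ :=
  -((Theta θ)⁻¹ *ᵥ lowerHalf θ)

end MultiTone

namespace MultiTone

/-! Write the output as `∑ q_l exp(λ_l t)` with `n` distinct imaginary exponents and nonzero `q_l`.
Since it is produced by the exosystem, every `λ_l` is a root of the polynomial `p_a` with
coefficients `a` (`IsExosystemSolution.charEval_eq_zero`). The Hurwitz filter forgets its initial
state: `η` is exponentially close to the moment vector `∑ β_l (1, λ_l, λ_l², …)`, where `β_l = q_l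
exp(λ_l t) / χ(λ_l)` and `χ` is the filter's characteristic polynomial (`exists_steadyState`). The
Hankel matrix of these moments is `Vᵀ diag(β) V` with `V` Vandermonde. As `|β_l|` is constant in
time, it is bounded below uniformly in `t`, and so is `Θ(η)` once the transient is small. Because
`p_a(λ_l) = 0`, the moments satisfy `Θ a + col = 0` exactly. Hence `Θ(η)` times the estimation error
has the size of the transient, and the lower bound transfers the decay to the error. -/

/-! ### Exponential decay for stable linear systems. -/

/-- `f` tends to zero exponentially on `[0, ∞)`. -/
def ExpDecays {E : Type*} [NormedAddCommGroup E] (f : ℝ → E) : Prop :=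
  ∃ C > 0, ∃ lam > 0, ∀ t, 0 ≤ t → ‖f t‖ ≤ C * Real.exp (-lam * t)

/-- A stable first-order equation driven by an exponentially decaying input has an exponentially
decaying solution. -/
theorem ExpDecays.of_hasDerivWithinAt_smul_add {E : Type*} [NormedAddCommGroup E]
    [NormedSpace ℂ E] {z g : ℝ → E} {μ : ℂ} (hμ : μ.re < 0) (hg : ExpDecays g)
    (hz : ∀ t ∈ Set.Ici (0 : ℝ), HasDerivWithinAt z (μ • z t + g t) (Set.Ici 0) t) :
    ExpDecays z := by
  obtain ⟨C, hC, lam, hlam, hg⟩ := hg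
  -- A rate strictly below both given ones avoids a separate resonant case `lam = -μ.re`.
  obtain ⟨κ, hκ0, hκ⟩ : ∃ κ, 0 < κ ∧ κ < min lam (-μ.re) :=
    exists_between (lt_min hlam (by linarith))
  have hκ1 : κ < lam := hκ.trans_le (min_le_left _ _)
  have hκ2 : κ < -μ.re := hκ.trans_le (min_le_right _ _)
  set δ := -μ.re - κ with hδ
  have hδ0 : 0 < δ := by linarith
  have hexp (t : ℝ) : HasDerivAt (fun s : ℝ => Complex.exp (-μ * s))
      (Complex.exp (-μ * t) * (-μ)) t := by
    have h := ((hasDerivAt_id (t : ℂ)).const_mul (-μ)).cexp.comp_ofReal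
    simpa using h
  have hnorm (t : ℝ) : ‖Complex.exp (-μ * t)‖ = Real.exp (-μ.re * t) := by
    simp [Complex.norm_exp]
  -- Integrating factor: the `μ • z` term cancels, and the remaining derivative is bounded by `C *
  -- exp (δ * t)`.
  have hw : ∀ t ∈ Set.Ici (0 : ℝ), HasDerivWithinAt (fun s : ℝ => Complex.exp (-μ * s) • z s)
      (Complex.exp (-μ * t) • g t) (Set.Ici 0) t := by
    intro t ht
    refine ((hexp t).hasDerivWithinAt.smul (hz t ht)).congr_deriv ?_
    rw [smul_add, smul_smul, mul_neg, neg_smul]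
    abel
  have hB (t : ℝ) : HasDerivAt (fun s => ‖z 0‖ + C / δ * Real.exp (δ * s))
      (C * Real.exp (δ * t)) t := by
    have h := ((((hasDerivAt_id t).const_mul δ).exp).const_mul (C / δ)).const_add ‖z 0‖
    refine h.congr_deriv ?_
    simp only [id]
    field_simp
  refine ⟨‖z 0‖ + C / δ, by positivity, κ, hκ0, fun t ht => ?_⟩
  have key := image_norm_le_of_norm_deriv_right_le_deriv_boundary
    (f := fun s : ℝ => Complex.exp (-μ * s) • z s)
    (f' := fun s => Complex.exp (-μ * s) • g s) (a := 0) (b := t)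
    (fun s hs => ((hw s hs.1).mono Set.Icc_subset_Ici_self).continuousWithinAt)
    (fun s hs => (hw s hs.1).mono (Set.Ici_subset_Ici.2 hs.1))
    (by simp; positivity) hB
    (fun s hs => by
      rw [norm_smul, hnorm]
      calc Real.exp (-μ.re * s) * ‖g s‖
          ≤ Real.exp (-μ.re * s) * (C * Real.exp (-lam * s)) := by
            gcongr; exact hg s hs.1
        _ = C * Real.exp ((-μ.re - lam) * s) := by
            rw [mul_left_comm, ← Real.exp_add]; ring_nf
        _ ≤ C * Real.exp (δ * s) := by
            gcongr
            · exact hs.1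
            · linarith)
    (Set.right_mem_Icc.2 ht)
  simp only [norm_smul, hnorm] at key
  have h1 : ‖z t‖ = Real.exp (μ.re * t) * (Real.exp (-μ.re * t) * ‖z t‖) := by
    rw [← mul_assoc, ← Real.exp_add]; simp
  have h2 : 1 ≤ Real.exp (δ * t) := Real.one_le_exp (by positivity)
  calc ‖z t‖ = Real.exp (μ.re * t) * (Real.exp (-μ.re * t) * ‖z t‖) := h1
    _ ≤ Real.exp (μ.re * t) * (‖z 0‖ + C / δ * Real.exp (δ * t)) := by gcongr
    _ ≤ Real.exp (μ.re * t) * (‖z 0‖ * Real.exp (δ * t) + C / δ * Real.exp (δ * t)) := by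
        gcongr
        exact le_mul_of_one_le_right (norm_nonneg _) h2
    _ = (‖z 0‖ + C / δ) * (Real.exp (μ.re * t) * Real.exp (δ * t)) := by ring
    _ = (‖z 0‖ + C / δ) * Real.exp (-κ * t) := by
        rw [← Real.exp_add]; congr 2; rw [hδ]; ring

theorem hasDerivWithinAt_mulVec {ι κ : Type*} [Fintype ι] [Fintype κ] (B : Matrix κ ι ℂ)
    {z : ℝ → ι → ℂ} {z' : ι → ℂ} {s : Set ℝ} {t : ℝ} (h : HasDerivWithinAt z z' s t) :
    HasDerivWithinAt (fun r => B *ᵥ z r) (B *ᵥ z') s t := by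
  rw [hasDerivWithinAt_pi] at h ⊢
  intro i
  simp only [Matrix.mulVec, dotProduct]
  exact HasDerivWithinAt.fun_sum fun j _ => (h j).const_mul _

/-- A solution of `z' = A z` that is annihilated by a polynomial in `A` with stable roots decays
exponentially. -/
theorem ExpDecays.of_aeval_mulVec_eq_zero {ι : Type*} [Fintype ι] [DecidableEq ι]
    (A : Matrix ι ι ℂ) (s : Multiset ℂ) (hs : ∀ μ ∈ s, μ.re < 0) (z : ℝ → ι → ℂ)
    (hz : ∀ t ∈ Set.Ici (0 : ℝ), HasDerivWithinAt z (A *ᵥ z t) (Set.Ici 0) t)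
    (h0 : ∀ t ∈ Set.Ici (0 : ℝ),
      Polynomial.aeval A (s.map fun μ => Polynomial.X - Polynomial.C μ).prod *ᵥ z t = 0) :
    ExpDecays z := by
  induction s using Multiset.induction_on generalizing z with
  | empty =>
    refine ⟨1, one_pos, 1, one_pos, fun t ht => ?_⟩
    have h := h0 t ht
    simp only [Multiset.map_zero, Multiset.prod_zero, map_one, Matrix.one_mulVec] at h
    rw [h, norm_zero]; positivity
  | cons μ s ih =>
    -- Peel off one root: `B z` solves the same equation and is killed by the remaining factors, so
    -- it decays; then `z' = μ z + B z`.
    set B : Matrix ι ι ℂ := A - algebraMap ℂ _ μ with hB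
    have hBA : B * A = A * B := by simp [hB, sub_mul, mul_sub, Algebra.commutes]
    have hdec : ExpDecays fun t => B *ᵥ z t := by
      refine ih (fun ν hν => hs ν (Multiset.mem_cons_of_mem hν)) _ (fun t ht => ?_) fun t ht => ?_
      · have h := hasDerivWithinAt_mulVec B (hz t ht)
        rwa [Matrix.mulVec_mulVec, hBA, ← Matrix.mulVec_mulVec] at h
      · have h := h0 t ht
        rw [Multiset.map_cons, Multiset.prod_cons, mul_comm, map_mul] at h
        rw [Matrix.mulVec_mulVec]
        simpa [hB] using h
    refine hdec.of_hasDerivWithinAt_smul_add (hs μ (Multiset.mem_cons_self _ _)) fun t ht => ?_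
    refine (hz t ht).congr_deriv ?_
    rw [hB, Matrix.sub_mulVec, Algebra.algebraMap_eq_smul_one, Matrix.smul_mulVec,
      Matrix.one_mulVec]
    abel

/-- Solutions of `z' = A z` decay exponentially if `A` is Hurwitz. -/
theorem IsHurwitz.expDecays {k : ℕ} {A : Matrix (Fin k) (Fin k) ℝ} (hA : IsHurwitz A)
    {z : ℝ → Fin k → ℂ}
    (hz : ∀ t ∈ Set.Ici (0 : ℝ),
      HasDerivWithinAt z (A.map (algebraMap ℝ ℂ) *ᵥ z t) (Set.Ici 0) t) :
    ExpDecays z := by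
  set B := A.map (algebraMap ℝ ℂ) with hB
  -- Cayley–Hamilton supplies the annihilating polynomial, so no diagonalization or Jordan form is
  -- needed.
  refine ExpDecays.of_aeval_mulVec_eq_zero B B.charpoly.roots (fun μ hμ => hA μ ?_) z hz ?_
  · rw [← hB, Matrix.mem_spectrum_iff_isRoot_charpoly]
    exact Polynomial.isRoot_of_mem_roots hμ
  · intro t _
    rw [← (IsAlgClosed.splits B.charpoly).eq_prod_roots_of_monic B.charpoly_monic,
      Matrix.aeval_self_charpoly, Matrix.zero_mulVec]

/-! ### Companion matrices. -/

/-- Entries of a companion matrix applied to a vector, above the last row. -/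
theorem companion_mulVec_of_lt {k : ℕ} (c x : Fin k → ℝ) (i : Fin k) (hi : (i : ℕ) + 1 < k) :
    (companion c *ᵥ x) i = x ⟨i + 1, hi⟩ := by
  rw [Matrix.mulVec, dotProduct, Finset.sum_eq_single ⟨i + 1, hi⟩]
  · simp [companion, hi.ne]
  · intro j _ hj
    have : (i : ℕ) + 1 ≠ j := fun h => hj (Fin.ext h.symm)
    simp [companion, hi.ne, this]
  · simp

/-- The last entry of a companion matrix applied to a vector. -/
theorem companion_mulVec_last {k : ℕ} (c x : Fin k → ℝ) (i : Fin k) (hi : (i : ℕ) + 1 = k) :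
    (companion c *ᵥ x) i = -∑ j, c j * x j := by
  simp [Matrix.mulVec, dotProduct, companion, hi]

/-- The monic polynomial `s ^ k + ∑ j, c_j s ^ j` evaluated at a complex point. -/
def charEval {k : ℕ} (c : Fin k → ℝ) (s : ℂ) : ℂ := s ^ k + ∑ j, (c j : ℂ) * s ^ (j : ℕ)

/-- The companion matrix acts on a geometric vector as multiplication by its ratio, up to the
characteristic polynomial in the last entry. -/
theorem companion_map_mulVec_pow {k : ℕ} (c : Fin k → ℝ) (s : ℂ) (i : Fin k) :
    ((companion c).map (algebraMap ℝ ℂ) *ᵥ fun j => s ^ (j : ℕ)) i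
      = s * s ^ (i : ℕ) - if (i : ℕ) + 1 = k then charEval c s else 0 := by
  by_cases hi : (i : ℕ) + 1 = k
  · have : s * s ^ (i : ℕ) = s ^ k := by rw [← pow_succ', hi]
    simp [Matrix.mulVec, dotProduct, companion, hi, charEval, this]
  · have hi' : (i : ℕ) + 1 < k := by omega
    rw [Matrix.mulVec, dotProduct, Finset.sum_eq_single ⟨i + 1, hi'⟩]
    · simp [companion, hi, pow_succ']
    · intro j _ hj
      have : (i : ℕ) + 1 ≠ j := fun h => hj (Fin.ext h.symm)
      simp [companion, hi, this]
    · simp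

/-- At a root `s`, the vector `(1, s, s², …)` would be an eigenvector, nonzero because `0 < k`, with
eigenvalue on the imaginary axis. -/
theorem IsHurwitz.charEval_ne_zero {k : ℕ} (hk : 0 < k) {c : Fin k → ℝ}
    (hc : IsHurwitz (companion c)) {s : ℂ} (hs : s.re = 0) : charEval c s ≠ 0 := by
  intro h0
  have hspec : s ∈ spectrum ℂ ((companion c).map (algebraMap ℝ ℂ)) := by
    rw [← Matrix.spectrum_toLin']
    refine Module.End.HasEigenvalue.mem_spectrum
      (Module.End.hasEigenvalue_of_hasEigenvector (x := fun j : Fin k => s ^ (j : ℕ)) ⟨?_, ?_⟩)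
    · rw [Module.End.mem_eigenspace_iff, Matrix.toLin'_apply]
      ext i
      rw [companion_map_mulVec_pow, h0]
      simp
    · intro h
      have := congrFun h ⟨0, hk⟩
      simp at this
  linarith [hc s hspec]

/-! ### Exponential sums and the exosystem output. -/

theorem hasDerivAt_expSum {n : ℕ} (lam q : Fin n → ℂ) (t : ℝ) :
    HasDerivAt (fun s : ℝ => ∑ l, q l * Complex.exp (lam l * s))
      (∑ l, q l * lam l * Complex.exp (lam l * t)) t := by
  refine HasDerivAt.fun_sum fun l _ => ?_
  have h := (((hasDerivAt_id (t : ℂ)).const_mul (lam l)).cexp.comp_ofReal).const_mul (q l)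
  refine h.congr_deriv ?_
  simp only [id]
  ring

/-- Exponentials with distinct exponents are linearly independent on `[0, ∞)`. -/
theorem eq_zero_of_expSum_eq_zero {n : ℕ} {lam : Fin n → ℂ} (hlam : Function.Injective lam)
    {q : Fin n → ℂ} (h : ∀ t : ℝ, 0 ≤ t → ∑ l, q l * Complex.exp (lam l * t) = 0) : q = 0 := by
  -- All derivatives vanish; at `t = 0` this is a Vandermonde system for `q`.
  have key : ∀ (i : ℕ) (t : ℝ), 0 ≤ t → ∑ l, q l * lam l ^ i * Complex.exp (lam l * t) = 0 := by
    intro i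
    induction i with
    | zero => simpa using h
    | succ i ih =>
      intro t ht
      have h1 := (hasDerivAt_expSum lam (fun l => q l * lam l ^ i) t).hasDerivWithinAt
        (s := Set.Ici 0)
      have h2 : HasDerivWithinAt
          (fun s : ℝ => ∑ l, q l * lam l ^ i * Complex.exp (lam l * s)) 0 (Set.Ici 0) t :=
        (hasDerivWithinAt_const t (Set.Ici 0) (0 : ℂ)).congr (fun s hs => ih s hs) (ih t ht)
      have h3 := (uniqueDiffOn_Ici (0 : ℝ) t ht).eq_deriv _ h1 h2
      simpa only [pow_succ, mul_assoc] using h3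
  refine Matrix.eq_zero_of_forall_pow_sum_mul_pow_eq_zero hlam fun i => ?_
  simpa using key i 0 le_rfl

theorem ofReal_sin_eq_exp (d x p : ℝ) (t : ℝ) :
    ((d * Real.sin (x * t + p) : ℝ) : ℂ)
      = -(d * Complex.exp (p * Complex.I) * Complex.I / 2) * Complex.exp (x * Complex.I * t)
        + d * Complex.exp (-(p * Complex.I)) * Complex.I / 2
          * Complex.exp (-(x * Complex.I) * t) := by
  push_cast
  have h1 : Complex.exp (((x : ℂ) * t + p) * Complex.I)
      = Complex.exp (p * Complex.I) * Complex.exp (x * Complex.I * t) := by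
    rw [← Complex.exp_add]; ring_nf
  have h2 : Complex.exp (-((x : ℂ) * t + p) * Complex.I)
      = Complex.exp (-(p * Complex.I)) * Complex.exp (-(x * Complex.I) * t) := by
    rw [← Complex.exp_add]; ring_nf
  rw [Complex.sin, h1, h2]
  ring

/-- A multi-tone signal is a sum of `n` complex exponentials with distinct imaginary exponents
and nonzero coefficients. -/
theorem IsMultiToneSignal.exists_expSum {n m : ℕ} {d₀ : ℝ} {d w φ : Fin m → ℝ} {y : ℝ → ℝ}
    (hy : IsMultiToneSignal n m d₀ d w φ y) :
    ∃ lam q : Fin n → ℂ, Function.Injective lam ∧ (∀ l, (lam l).re = 0) ∧ (∀ l, q l ≠ 0) ∧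
      ∀ t : ℝ, 0 ≤ t → (y t : ℂ) = ∑ l, q l * Complex.exp (lam l * t) := by
  suffices H : ∃ (ι : Type) (_ : Fintype ι) (_ : Fintype.card ι = n) (lam q : ι → ℂ),
      Function.Injective lam ∧ (∀ l, (lam l).re = 0) ∧ (∀ l, q l ≠ 0) ∧
      ∀ t : ℝ, 0 ≤ t → (y t : ℂ) = ∑ l, q l * Complex.exp (lam l * t) by
    obtain ⟨ι, _, hcard, lam, q, h1, h2, h3, h4⟩ := H
    let e : Fin n ≃ ι := (Fintype.equivFinOfCardEq hcard).symm
    refine ⟨lam ∘ e, q ∘ e, h1.comp e.injective, fun l => h2 _, fun l => h3 _, fun t ht => ?_⟩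
    rw [h4 t ht, ← e.sum_comp]
    rfl
  let lam : Fin m ⊕ Fin m → ℂ :=
    Sum.elim (fun k => w k * Complex.I) (fun k => -(w k * Complex.I))
  let q : Fin m ⊕ Fin m → ℂ :=
    Sum.elim (fun k => -(d k * Complex.exp (φ k * Complex.I) * Complex.I / 2))
      (fun k => d k * Complex.exp (-(φ k * Complex.I)) * Complex.I / 2)
  have hre : ∀ l, (lam l).re = 0 := by rintro (k | k) <;> simp [lam]
  have hq : ∀ l, q l ≠ 0 := by
    rintro (k | k) <;> simp [q, hy.amplitude_ne_zero, Complex.exp_ne_zero]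
  have hne : ∀ l, lam l ≠ 0 := by rintro (k | k) <;> simp [lam, hy.frequency_ne_zero]
  -- Distinct absolute values keep the conjugate exponents `±i w` of different tones apart.
  have hopp : ∀ k j, w k ≠ -w j := by
    intro k j h
    have hkj : k = j := hy.frequency_distinct (by simp [h])
    subst hkj
    exact hy.frequency_ne_zero k (by linarith)
  have hinj : Function.Injective lam := by
    rintro (k | k) (j | j) h <;> have him := congrArg Complex.im h <;> simp [lam] at him
    · rw [hy.frequency_distinct (congrArg abs him)]
    · exact (hopp _ _ him).elim
    · exact (hopp _ _ him.symm).elim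
    · rw [hy.frequency_distinct (congrArg abs him)]
  have hsum : ∀ t : ℝ, 0 ≤ t → (y t : ℂ) = d₀ + ∑ l, q l * Complex.exp (lam l * t) := by
    intro t ht
    rw [hy.eq_sum t ht, Complex.ofReal_add, Complex.ofReal_sum, Fintype.sum_sum_type,
      ← Finset.sum_add_distrib]
    exact congrArg _ (Finset.sum_congr rfl fun k _ => ofReal_sin_eq_exp _ _ _ _)
  rcases hy.order with ⟨hn, hd⟩ | ⟨hn, hd⟩
  · refine ⟨Fin m ⊕ Fin m, inferInstance, by simp [hn, two_mul], lam, q, hinj, hre, hq, ?_⟩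
    simpa [hd] using hsum
  -- The bias is the extra exponent `0` with coefficient `d₀`, making `2m + 1` in all.
  · refine ⟨Option (Fin m ⊕ Fin m), inferInstance, by simp [hn, two_mul],
      fun o => o.elim 0 lam, fun o => o.elim (d₀ : ℂ) q, ?_, ?_, ?_, ?_⟩
    · rintro (_ | l) (_ | l') h
      · rfl
      · exact (hne l' h.symm).elim
      · exact (hne l h).elim
      · exact congrArg some (hinj h)
    · rintro (_ | l)
      · simp
      · exact hre l
    · rintro (_ | l)
      · simpa using hd
      · exact hq l
    · intro t ht
      simpa [Fintype.sum_option] using hsum t ht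

/-- The exponents of the output of the exosystem are roots of its characteristic polynomial. -/
theorem IsExosystemSolution.charEval_eq_zero {n : ℕ} {a : Fin n → ℝ} {v : ℝ → Fin n → ℝ}
    (hv : IsExosystemSolution a v) {lam q : Fin n → ℂ} (hlam : Function.Injective lam)
    (hq : ∀ l, q l ≠ 0)
    (hy : ∀ t : ℝ, 0 ≤ t →
      ((Gam n ⬝ᵥ v t : ℝ) : ℂ) = ∑ l, q l * Complex.exp (lam l * t)) (l : Fin n) :
    charEval a (lam l) = 0 := by
  have hderiv (i : Fin n) (t : ℝ) (ht : 0 ≤ t) :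
      HasDerivWithinAt (fun s => (v s i : ℂ)) (((companion a *ᵥ v t) i : ℝ) : ℂ) (Set.Ici 0) t :=
    (hasDerivWithinAt_pi.1 (hv t ht) i).ofReal_comp
  have hexp (i : ℕ) (t : ℝ) := (hasDerivAt_expSum lam (fun l => q l * lam l ^ i) t).hasDerivWithinAt
    (s := Set.Ici 0)
  -- The superdiagonal ones make the components of `v` the successive derivatives of the output.
  have key : ∀ (i : ℕ) (hi : i < n) (t : ℝ), 0 ≤ t →
      (v t ⟨i, hi⟩ : ℂ) = ∑ l, q l * lam l ^ i * Complex.exp (lam l * t) := by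
    intro i
    induction i with
    | zero =>
      intro hi t ht
      have : Gam n ⬝ᵥ v t = v t ⟨0, hi⟩ := by
        rw [dotProduct, Finset.sum_eq_single ⟨0, hi⟩]
        · simp [Gam]
        · intro j _ hj
          have : (j : ℕ) ≠ 0 := fun h => hj (Fin.ext h)
          simp [Gam, this]
        · simp
      simpa [this] using hy t ht
    | succ i ih =>
      intro hi t ht
      have h1 := (hderiv ⟨i, by omega⟩ t ht).congr (fun s hs => (ih (by omega) s hs).symm)
        (ih (by omega) t ht).symm
      rw [companion_mulVec_of_lt a (v t) ⟨i, by omega⟩ hi] at h1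
      rw [(uniqueDiffOn_Ici (0 : ℝ) t ht).eq_deriv _ h1 (hexp i t)]
      simp only [pow_succ, mul_assoc]
  obtain ⟨k, rfl⟩ : ∃ k, n = k + 1 := ⟨n - 1, by have := l.pos; omega⟩
  -- The last row closes the chain into a scalar equation of order `n`; independence of the
  -- exponentials separates its terms.
  have hzero : (fun l => q l * charEval a (lam l)) = 0 := by
    refine eq_zero_of_expSum_eq_zero hlam fun t ht => ?_
    have h1 := (hderiv (Fin.last k) t ht).congr (fun s hs => (key k k.lt_succ_self s hs).symm)
      (key k k.lt_succ_self t ht).symm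
    rw [companion_mulVec_last a (v t) (Fin.last k) (by simp)] at h1
    have h2 := (uniqueDiffOn_Ici (0 : ℝ) t ht).eq_deriv _ h1 (hexp k t)
    have h3 : ((∑ j, a j * v t j : ℝ) : ℂ)
        = ∑ l, q l * (∑ j, (a j : ℂ) * lam l ^ (j : ℕ)) * Complex.exp (lam l * t) := by
      push_cast
      simp_rw [Finset.mul_sum, Finset.sum_mul]
      rw [Finset.sum_comm]
      refine Finset.sum_congr rfl fun j _ => ?_
      rw [key j j.2 t ht, Finset.mul_sum]
      exact Finset.sum_congr rfl fun l _ => by ring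
    rw [Complex.ofReal_neg, h3, neg_eq_iff_add_eq_zero, ← Finset.sum_add_distrib] at h2
    rw [← h2]
    refine Finset.sum_congr rfl fun l _ => ?_
    rw [charEval, pow_succ]
    ring
  exact (mul_eq_zero.1 (congrFun hzero l)).resolve_left (hq l)

/-! ### Hankel matrices of moments. -/

/-- The vector `∑ l, β_l (1, s_l, s_l², …)` of moments. -/
def moments {n : ℕ} (lam β : Fin n → ℂ) : Fin (2 * n) → ℂ :=
  fun i => ∑ l, β l * lam l ^ (i : ℕ)

/-- The complex Hankel matrix of `θ` applied to `x`. -/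
def hankelMulVec {n : ℕ} (θ : Fin (2 * n) → ℂ) (x : Fin n → ℂ) : Fin n → ℂ :=
  fun i => ∑ j : Fin n, θ ⟨(i : ℕ) + (j : ℕ), by omega⟩ * x j

theorem hankelMulVec_add {n : ℕ} (θ θ' : Fin (2 * n) → ℂ) (x : Fin n → ℂ) :
    hankelMulVec (θ + θ') x = hankelMulVec θ x + hankelMulVec θ' x := by
  ext i
  simp [hankelMulVec, add_mul, Finset.sum_add_distrib]

theorem ofReal_Theta_mulVec {n : ℕ} (θ : Fin (2 * n) → ℝ) (x : Fin n → ℝ) :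
    (fun i => ((Theta θ *ᵥ x) i : ℂ)) = hankelMulVec (fun i => (θ i : ℂ)) fun j => (x j : ℂ) := by
  ext i
  simp [hankelMulVec, Theta, Matrix.mulVec, dotProduct]

theorem norm_hankelMulVec_le {n : ℕ} (θ : Fin (2 * n) → ℂ) (x : Fin n → ℂ) :
    ‖hankelMulVec θ x‖ ≤ n * ‖θ‖ * ‖x‖ := by
  refine (pi_norm_le_iff_of_nonneg (by positivity)).2 fun i => ?_
  calc ‖hankelMulVec θ x i‖ ≤ ∑ _j : Fin n, ‖θ‖ * ‖x‖ := by
        refine (norm_sum_le _ _).trans (Finset.sum_le_sum fun j _ => ?_)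
        rw [norm_mul]
        exact mul_le_mul (norm_le_pi_norm θ _) (norm_le_pi_norm x j) (norm_nonneg _)
          (norm_nonneg _)
    _ = n * ‖θ‖ * ‖x‖ := by simp [mul_assoc]

theorem norm_ofReal_pi {ι : Type*} [Fintype ι] (x : ι → ℝ) :
    ‖fun i => (x i : ℂ)‖ = ‖x‖ := by
  simp [Pi.norm_def]

/-- The Hankel matrix of moments factors through Vandermonde matrices. -/
theorem hankelMulVec_moments {n : ℕ} (lam β x : Fin n → ℂ) :
    hankelMulVec (moments lam β) x
      = (Matrix.vandermonde lam)ᵀ *ᵥ fun l => β l * (Matrix.vandermonde lam *ᵥ x) l := by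
  ext i
  simp only [hankelMulVec, moments, Matrix.mulVec, dotProduct, Matrix.transpose_apply,
    Matrix.vandermonde_apply, Finset.sum_mul, Finset.mul_sum]
  rw [Finset.sum_comm]
  exact Finset.sum_congr rfl fun l _ => Finset.sum_congr rfl fun j _ => by
    rw [pow_add]; ring

theorem exists_norm_le_mul_norm_mulVec {ι : Type*} [Fintype ι] [DecidableEq ι]
    (V : Matrix ι ι ℂ) (hV : IsUnit V) : ∃ K > 0, ∀ x, ‖x‖ ≤ K * ‖V *ᵥ x‖ := by
  obtain ⟨K, hK, h⟩ := V.mulVecLin.exists_antilipschitzWith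
    (LinearMap.ker_eq_bot.2 (Matrix.mulVec_injective_iff_isUnit.2 hV))
  exact ⟨K, hK, fun x => h.le_mul_norm (map_zero _) x⟩

/-- Hankel matrices of moments with distinct nodes are bounded below, uniformly in the phases of
the weights. -/
theorem exists_norm_le_mul_norm_hankelMulVec {n : ℕ} {lam b : Fin n → ℂ}
    (hlam : Function.Injective lam) (hb : ∀ l, b l ≠ 0) :
    ∃ K > 0, ∀ β : Fin n → ℂ, (∀ l, ‖β l‖ = ‖b l‖) → ∀ x,
      ‖x‖ ≤ K * ‖hankelMulVec (moments lam β) x‖ := by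
  have hdet : IsUnit (Matrix.vandermonde lam).det :=
    (Matrix.det_vandermonde_ne_zero_iff.2 hlam).isUnit
  obtain ⟨K₁, hK₁, h₁⟩ := exists_norm_le_mul_norm_mulVec _
    ((Matrix.isUnit_iff_isUnit_det _).2 hdet)
  obtain ⟨K₂, hK₂, h₂⟩ := exists_norm_le_mul_norm_mulVec (Matrix.vandermonde lam)ᵀ
    ((Matrix.isUnit_iff_isUnit_det _).2 (by rwa [Matrix.det_transpose]))
  -- `B` dominates every `‖b l‖⁻¹`; the `1` keeps it positive when `n = 0`.
  set B : ℝ := 1 + ∑ l, ‖b l‖⁻¹ with hB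
  have hB0 : 0 < B := by positivity
  refine ⟨K₁ * (B * K₂), by positivity, fun β hβ x => ?_⟩
  have h3 : ‖Matrix.vandermonde lam *ᵥ x‖
      ≤ B * ‖fun l => β l * (Matrix.vandermonde lam *ᵥ x) l‖ := by
    refine (pi_norm_le_iff_of_nonneg (by positivity)).2 fun l => ?_
    have hpos : 0 < ‖b l‖ := norm_pos_iff.2 (hb l)
    have hle : ‖b l‖⁻¹ ≤ B := by
      have := Finset.single_le_sum (f := fun l => ‖b l‖⁻¹) (fun _ _ => by positivity)
        (Finset.mem_univ l)
      linarith
    calc ‖(Matrix.vandermonde lam *ᵥ x) l‖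
        = ‖b l‖⁻¹ * ‖β l * (Matrix.vandermonde lam *ᵥ x) l‖ := by
          rw [norm_mul, hβ]; field_simp
      _ ≤ _ := mul_le_mul hle (norm_le_pi_norm (fun l => β l * (Matrix.vandermonde lam *ᵥ x) l) l)
          (norm_nonneg _) hB0.le
  calc ‖x‖ ≤ K₁ * ‖Matrix.vandermonde lam *ᵥ x‖ := h₁ x
    _ ≤ K₁ * (B * (K₂ * ‖hankelMulVec (moments lam β) x‖)) := by
        rw [hankelMulVec_moments]
        gcongr
        exact h3.trans (by gcongr; exact h₂ _)
    _ = _ := by ring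

/-- The upper part of the moments is a linear recurrence in the lower part when the nodes are roots
of the characteristic polynomial. -/
theorem hankelMulVec_moments_add_eq_zero {n : ℕ} {a : Fin n → ℝ} {lam : Fin n → ℂ}
    (ha : ∀ l, charEval a (lam l) = 0) (β : Fin n → ℂ) (i : Fin n) :
    hankelMulVec (moments lam β) (fun j => (a j : ℂ)) i
      + moments lam β ⟨n + (i : ℕ), by omega⟩ = 0 := by
  have : ∀ l, β l * lam l ^ (i : ℕ) * charEval a (lam l) = 0 := fun l => by rw [ha, mul_zero]
  rw [← Finset.sum_eq_zero fun l (_ : l ∈ Finset.univ) => this l]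
  simp only [hankelMulVec, moments, charEval, Finset.sum_mul]
  rw [Finset.sum_comm, ← Finset.sum_add_distrib]
  refine Finset.sum_congr rfl fun l _ => ?_
  rw [mul_add, Finset.mul_sum, add_comm]
  congr 1
  · rw [pow_add]; ring
  · exact Finset.sum_congr rfl fun j _ => by rw [pow_add]; ring

/-! ### Steady state and smoothness of the filter. -/

/-- The observer state is a moment vector with phase-rotating weights up to an exponentially
decaying error. -/
theorem exists_steadyState {n : ℕ} {c : Fin (2 * n) → ℝ} (hM : IsHurwitz (companion c))
    {lam q : Fin n → ℂ} (hre : ∀ l, (lam l).re = 0) (hq : ∀ l, q l ≠ 0) {y : ℝ → ℝ}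
    (hy : ∀ t : ℝ, 0 ≤ t → (y t : ℂ) = ∑ l, q l * Complex.exp (lam l * t))
    {η : ℝ → Fin (2 * n) → ℝ}
    (hη : ∀ t ∈ Set.Ici (0 : ℝ),
      HasDerivWithinAt η (companion c *ᵥ η t + y t • Nvec n) (Set.Ici 0) t) :
    ∃ (b : Fin n → ℂ) (β : ℝ → Fin n → ℂ), (∀ l, b l ≠ 0) ∧ (∀ t l, ‖β t l‖ = ‖b l‖) ∧
      ExpDecays fun t => (fun i => (η t i : ℂ)) - moments lam (β t) := by
  have hχ (l : Fin n) : charEval c (lam l) ≠ 0 :=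
    hM.charEval_ne_zero (by have := l.pos; omega) (hre l)
  let b : Fin n → ℂ := fun l => q l / charEval c (lam l)
  let β : ℝ → Fin n → ℂ := fun t l => b l * Complex.exp (lam l * t)
  refine ⟨b, β, fun l => div_ne_zero (hq l) (hχ l), fun t l => ?_, hM.expDecays fun t ht => ?_⟩
  · simp [β, Complex.norm_exp, hre l]
  · have hm : HasDerivWithinAt (fun s => moments lam (β s))
        (fun i : Fin (2 * n) => ∑ l, b l * lam l ^ (i : ℕ) * lam l * Complex.exp (lam l * t))
        (Set.Ici 0) t := by
      refine hasDerivWithinAt_pi.2 fun i => ?_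
      have h := hasDerivAt_expSum lam (fun l => b l * lam l ^ (i : ℕ)) t
      refine (h.hasDerivWithinAt (s := Set.Ici 0)).congr_of_mem (fun s _ => ?_) ht
      exact Finset.sum_congr rfl fun l _ => by simp only [β]; ring
    have hη' : HasDerivWithinAt (fun s i => (η s i : ℂ))
        (fun i => (((companion c *ᵥ η t + y t • Nvec n) i : ℝ) : ℂ)) (Set.Ici 0) t :=
      hasDerivWithinAt_pi.2 fun i => (hasDerivWithinAt_pi.1 (hη t ht) i).ofReal_comp
    refine (hη'.sub hm).congr_deriv ?_
    rw [Matrix.mulVec_sub]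
    have hsplit : moments lam (β t)
        = ∑ l, β t l • fun i : Fin (2 * n) => lam l ^ (i : ℕ) := by
      ext i; simp [moments]
    ext i
    have hmap : ((companion c).map (algebraMap ℝ ℂ) *ᵥ fun i => (η t i : ℂ)) i
        = (((companion c *ᵥ η t) i : ℝ) : ℂ) := by
      simp [Matrix.mulVec, dotProduct]
    have hmul : ((companion c).map (algebraMap ℝ ℂ) *ᵥ moments lam (β t)) i
        = ∑ l, β t l * (lam l * lam l ^ (i : ℕ)
          - if (i : ℕ) + 1 = 2 * n then charEval c (lam l) else 0) := by
      rw [hsplit, Matrix.mulVec_sum, Finset.sum_apply]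
      refine Finset.sum_congr rfl fun l _ => ?_
      rw [Matrix.mulVec_smul, Pi.smul_apply, companion_map_mulVec_pow, smul_eq_mul]
    -- Dividing by `charEval c (lam l)` in `b` makes the input match the last-row defect of each
    -- geometric vector.
    have hN : (((y t • Nvec n) i : ℝ) : ℂ)
        = ∑ l, β t l * if (i : ℕ) + 1 = 2 * n then charEval c (lam l) else 0 := by
      by_cases hi : (i : ℕ) + 1 = 2 * n
      · simp only [Pi.smul_apply, Nvec, hi, if_true, smul_eq_mul, mul_one, hy t ht, β, b]
        refine Finset.sum_congr rfl fun l _ => ?_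
        field_simp [hχ l]
      · simp [Nvec, hi]
    simp only [Pi.sub_apply, hmap, hmul, Pi.add_apply, Complex.ofReal_add, hN, mul_sub,
      Finset.sum_sub_distrib]
    have : ∑ l, b l * lam l ^ (i : ℕ) * lam l * Complex.exp (lam l * t)
        = ∑ l, β t l * (lam l * lam l ^ (i : ℕ)) :=
      Finset.sum_congr rfl fun l _ => by simp only [β]; ring
    rw [this]
    ring

/-- Solutions of a linear equation with smooth input are smooth. -/
theorem contDiffOn_of_linear_ode {k : ℕ} (A : Matrix (Fin k) (Fin k) ℝ)
    {η u : ℝ → Fin k → ℝ} (hu : ContDiffOn ℝ ∞ u (Set.Ici 0))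
    (hη : ∀ t ∈ Set.Ici (0 : ℝ), HasDerivWithinAt η (A *ᵥ η t + u t) (Set.Ici 0) t) :
    ContDiffOn ℝ ∞ η (Set.Ici 0) := by
  have hd : DifferentiableOn ℝ η (Set.Ici 0) := fun t ht => (hη t ht).differentiableWithinAt
  -- Bootstrap: if `η` is `C^r`, the equation makes its derivative `C^r`.
  refine contDiffOn_infty.2 fun r => ?_
  induction r with
  | zero => exact contDiffOn_zero.2 hd.continuousOn
  | succ r ih =>
    rw [Nat.cast_add, Nat.cast_one, contDiffOn_succ_iff_derivWithin (uniqueDiffOn_Ici 0)]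
    refine ⟨hd, by simp, ?_⟩
    have h1 : ContDiffOn ℝ r (fun t => A.mulVecLin.toContinuousLinearMap (η t) + u t)
        (Set.Ici 0) :=
      (A.mulVecLin.toContinuousLinearMap.contDiff.comp_contDiffOn ih).add
        (contDiffOn_infty.1 hu r)
    refine h1.congr fun t ht => ?_
    rw [(hη t ht).derivWithin (uniqueDiffOn_Ici 0 t ht)]
    rfl

theorem IsMultiToneSignal.contDiffOn {n m : ℕ} {d₀ : ℝ} {d w φ : Fin m → ℝ} {y : ℝ → ℝ}
    (hy : IsMultiToneSignal n m d₀ d w φ y) : ContDiffOn ℝ ∞ y (Set.Ici 0) := by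
  have h : ContDiff ℝ ∞ fun t : ℝ => d₀ + ∑ k, d k * Real.sin (w k * t + φ k) := by
    fun_prop
  exact h.contDiffOn.congr hy.eq_sum

end MultiTone

/-! ### Convergence of the estimate. -/

theorem mainTheorem5 (n m : ℕ)
    -- the unknown parameter vector, the exosystem `v' = Φ(a) v` and its output `y₀ = Γ v`
    (a : Fin n → ℝ) (ha : MultiTone.HasDistinctImaginaryEigenvalues (MultiTone.companion a))
    (v : ℝ → Fin n → ℝ) (hv : MultiTone.IsExosystemSolution a v)
    (y₀ : ℝ → ℝ) (hy₀ : ∀ t, 0 ≤ t → y₀ t = MultiTone.Gam n ⬝ᵥ v t)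
    (d₀ : ℝ) (d w φ : Fin m → ℝ) (hy : MultiTone.IsMultiToneSignal n m d₀ d w φ y₀)
    -- the observer
    (c : Fin (2 * n) → ℝ) (hM : MultiTone.IsHurwitz (MultiTone.companion c))
    (k₁ : ℝ) (hk₁ : 0 < k₁) (η : ℝ → Fin (2 * n) → ℝ) (ahat : ℝ → Fin n → ℝ)
    (hobs : MultiTone.IsObserverSolution c k₁ y₀ η ahat) :
    ∃ t₀ : ℝ, 0 ≤ t₀ ∧
      (∀ t, t₀ ≤ t → IsUnit (MultiTone.Theta (η t))) ∧
      (∀ i j, ContDiffOn ℝ ∞ (fun t => MultiTone.Theta (η t) i j) (Set.Ici t₀)) ∧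
      ∃ C > 0, ∃ lam > 0, ∀ t, t₀ ≤ t →
        ‖WithLp.toLp 2 (a - MultiTone.explicitEstimate (η t))‖
          ≤ C * Real.exp (-lam * (t - t₀)) := by
  open MultiTone in
  obtain ⟨lam, q, hinj, hre, hq, hsum⟩ := hy.exists_expSum
  have hchar := hv.charEval_eq_zero hinj hq fun t ht => by rw [← hy₀ t ht, hsum t ht]
  obtain ⟨b, β, hb, hβ, C, hC, κ, hκ, hdec⟩ := exists_steadyState hM hre hq hsum hobs.eta_ode
  obtain ⟨K, hK, hbelow⟩ := exists_norm_le_mul_norm_hankelMulVec hinj hb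
  set z : ℝ → Fin (2 * n) → ℂ := fun t => (fun i => (η t i : ℂ)) - moments lam (β t) with hz
  have hηz (t : ℝ) : (fun i => (η t i : ℂ)) = moments lam (β t) + z t := by simp [hz]
  -- With `1 / 2` the transient's contribution is absorbed in the left side of the lower bound,
  -- which turns `K` into `2 * K`.
  have hsmall : ∀ᶠ t : ℝ in Filter.atTop, K * (n * (C * Real.exp (-κ * t))) < 1 / 2 := by
    have h : Filter.Tendsto (fun t : ℝ => K * (n * (C * Real.exp (-κ * t)))) Filter.atTop
        (nhds (K * (n * (C * 0)))) :=
      (((Real.tendsto_exp_atBot.comp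
        (Filter.tendsto_id.const_mul_atTop_of_neg (neg_neg_of_pos hκ))).const_mul C).const_mul
          (n : ℝ)).const_mul K
    exact h.eventually_lt_const (by norm_num)
  obtain ⟨t₁, ht₁⟩ := Filter.eventually_atTop.1 hsmall
  have hlow (t : ℝ) (ht : max t₁ 0 ≤ t) (x : Fin n → ℝ) :
      ‖x‖ ≤ 2 * K * ‖Theta (η t) *ᵥ x‖ := by
    have h1 := hbelow (β t) (hβ t) fun j => (x j : ℂ)
    have h2 := ofReal_Theta_mulVec (η t) x
    rw [hηz, hankelMulVec_add] at h2
    have h3 := norm_hankelMulVec_le (z t) fun j => (x j : ℂ)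
    have h4 := norm_sub_le (fun i => ((Theta (η t) *ᵥ x) i : ℂ))
      (hankelMulVec (z t) fun j => (x j : ℂ))
    rw [show (fun i => ((Theta (η t) *ᵥ x) i : ℂ)) - (hankelMulVec (z t) fun j => (x j : ℂ))
      = hankelMulVec (moments lam (β t)) fun j => (x j : ℂ) by rw [h2, add_sub_cancel_right]] at h4
    rw [norm_ofReal_pi] at h1 h3 h4
    have h5 : K * (n * ‖z t‖) ≤ 1 / 2 :=
      le_trans (by gcongr; exact hdec t (le_of_max_le_right ht))
        (ht₁ t (le_of_max_le_left ht)).le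
    have h6 : ‖x‖ ≤ K * ‖Theta (η t) *ᵥ x‖ + K * (n * ‖z t‖) * ‖x‖ :=
      calc ‖x‖ ≤ K * (‖Theta (η t) *ᵥ x‖ + n * ‖z t‖ * ‖x‖) :=
            h1.trans (by gcongr; exact h4.trans (by gcongr))
        _ = _ := by ring
    have h7 : K * (n * ‖z t‖) * ‖x‖ ≤ 1 / 2 * ‖x‖ := by gcongr
    linarith
  have hunit (t : ℝ) (ht : max t₁ 0 ≤ t) : IsUnit (Theta (η t)) := by
    refine Matrix.mulVec_injective_iff_isUnit.1 fun x x' hx => ?_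
    have h := hlow t ht (x - x')
    rw [Matrix.mulVec_sub, sub_eq_zero.2 hx, norm_zero, mul_zero] at h
    exact sub_eq_zero.1 (norm_le_zero_iff.1 h)
  refine ⟨max t₁ 0, le_max_right _ _, hunit, fun i j => ?_, ?_⟩
  · have hη := contDiffOn_of_linear_ode (companion c)
      (hy.contDiffOn.smul contDiffOn_const) hobs.eta_ode
    exact (contDiffOn_pi.1 hη _).mono (Set.Ici_subset_Ici.2 (le_max_right _ _))
  · obtain ⟨L, hL, hLle⟩ : ∃ L > 0, ∀ x : Fin n → ℝ, ‖WithLp.toLp 2 x‖ ≤ L * ‖x‖ := by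
      let T := (PiLp.continuousLinearEquiv 2 ℝ fun _ : Fin n => ℝ).symm.toContinuousLinearMap
      refine ⟨‖T‖ + 1, by positivity, fun x => (T.le_opNorm x).trans ?_⟩
      gcongr
      linarith
    refine ⟨L * (2 * K * ((n * ‖a‖ + 1) * C)), by positivity, κ, hκ, fun t ht => ?_⟩
    have ht0 : 0 ≤ t := le_of_max_le_right ht
    have hres : Theta (η t) *ᵥ (a - explicitEstimate (η t))
        = Theta (η t) *ᵥ a + lowerHalf (η t) := by
      rw [explicitEstimate, sub_neg_eq_add, Matrix.mulVec_add, Matrix.mulVec_mulVec,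
        Matrix.mul_nonsing_inv _ ((Matrix.isUnit_iff_isUnit_det _).1 (hunit t ht)),
        Matrix.one_mulVec]
    have hresle : ‖Theta (η t) *ᵥ a + lowerHalf (η t)‖ ≤ (n * ‖a‖ + 1) * ‖z t‖ := by
      rw [← norm_ofReal_pi]
      refine (pi_norm_le_iff_of_nonneg (by positivity)).2 fun i => ?_
      have h1 := congrFun (ofReal_Theta_mulVec (η t) a) i
      have h2 := congrFun (hηz t) ⟨n + (i : ℕ), by omega⟩
      have h3 := hankelMulVec_moments_add_eq_zero hchar (β t) i
      rw [hηz, hankelMulVec_add] at h1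
      -- The moment part drops out by the recurrence, leaving only terms linear in `z t`.
      have h4 : (((Theta (η t) *ᵥ a + lowerHalf (η t)) i : ℝ) : ℂ)
          = hankelMulVec (z t) (fun j => (a j : ℂ)) i + z t ⟨n + (i : ℕ), by omega⟩ := by
        simp only [Pi.add_apply, lowerHalf, Complex.ofReal_add] at h1 h2 ⊢
        rw [h1, h2]
        linear_combination h3
      rw [h4]
      have h5 := norm_hankelMulVec_le (z t) fun j => (a j : ℂ)
      rw [norm_ofReal_pi] at h5
      calc _ ≤ n * ‖z t‖ * ‖a‖ + ‖z t‖ := (norm_add_le _ _).trans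
            (add_le_add ((norm_le_pi_norm _ i).trans h5) (norm_le_pi_norm _ _))
        _ = _ := by ring
    calc ‖WithLp.toLp 2 (a - explicitEstimate (η t))‖
        ≤ L * ‖a - explicitEstimate (η t)‖ := hLle _
      _ ≤ L * (2 * K * ((n * ‖a‖ + 1) * ‖z t‖)) := by
          gcongr
          refine (hlow t ht _).trans ?_
          rw [hres]
          gcongr
      -- Shifting the origin of time to `t₀ ≥ 0` only weakens the bound.
      _ ≤ L * (2 * K * ((n * ‖a‖ + 1) * (C * Real.exp (-κ * (t - max t₁ 0))))) := by
          gcongr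
          refine (hdec t ht0).trans ?_
          refine mul_le_mul_of_nonneg_left (Real.exp_le_exp.2 ?_) hC.le
          have : 0 ≤ κ * max t₁ 0 := mul_nonneg hκ.le (le_max_right _ _)
          nlinarith
      _ = _ := by ring
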